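/- A continuum is a nonempty compact connected Hausdorff space; a subcontinuum of a space is a subspace that is a continuum. A continuum $K$ is indecomposable if it is not the union of two proper subcontinua, and the composant of a point $x \in K$ is the union of all proper subcontinua of $K$ that contain $x$. A function $f : X \to Y$ is continuum-preserving (respectively connectedness-preserving) if $f(A)$ is a continuum (respectively connected) for every subspace $A \subseteq X$ that is a continuum (respectively connected). Maps are not assumed to be continuous. For every indecomposable metrizable continuum $K$ with more than one point there is a function $f : K \to [0,1]$ that is continuum-preserving but not connectedness-preserving, and that moreover is surjective and constant on each composant of $K$. -/

import Mathlib

/-- A subset of a Hausdorff space is a continuum if, as a subspace, it is compact and connected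
(connected includes nonempty). -/
def IsContinuum {X : Type*} [TopologicalSpace X] [T2Space X] (s : Set X) : Prop :=
  IsCompact s ∧ IsConnected s

/-- A Hausdorff space is an indecomposable continuum if it is a continuum that is not
the union of two proper subcontinua. -/
def IsIndecomposableContinuum (X : Type*) [TopologicalSpace X] [T2Space X] : Prop :=
  IsContinuum (Set.univ : Set X) ∧
    ∀ A B : Set X, IsContinuum A → IsContinuum B → A ∪ B = Set.univ →
      A = Set.univ ∨ B = Set.univ

/-- The composant of `x`: the union of all proper subcontinua that contain `x`. -/
def composant {X : Type*} [TopologicalSpace X] [T2Space X] (x : X) : Set X :=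
  ⋃₀ {A : Set X | IsContinuum A ∧ A ≠ Set.univ ∧ x ∈ A}

/-- The image of every subcontinuum is a continuum. -/
def ContinuumPreserving {X Y : Type*} [TopologicalSpace X] [T2Space X] [TopologicalSpace Y]
    [T2Space Y] (f : X → Y) : Prop :=
  ∀ A : Set X, IsContinuum A → IsContinuum (f '' A)

/-- The image of every connected subspace is connected. -/
def ConnectednessPreserving {X Y : Type*} [TopologicalSpace X] [TopologicalSpace Y]
    (f : X → Y) : Prop :=
  ∀ A : Set X, IsConnected A → IsConnected (f '' A)

/-!
The composants of an indecomposable continuum `K` partition it: if two proper subcontinua meet,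
their union is a subcontinuum, and it is proper by indecomposability. Each composant is connected,
and it is dense by the boundary bumping argument (`dense_composant`).

There are at least continuum many composants. Proper subcontinua of `K` have empty interior
(`IsIndecomposableContinuum.interior_eq_empty`). If `B n` runs through a countable base of
nonempty open sets, then the relation "`x` and `y` lie in the same composant" is the union of the
relations `componentRel (B n)ᶜ`: "`x` and `y` lie in the same component of `K \ B n`". Each of
these is closed, because components of compact spaces are intersections of clopen sets, and it has
empty interior, because its sections are proper subcontinua. By a theorem of Mycielski
(`exists_cantor_family`), proved with a Cantor scheme, there is a family of points indexed by
`ℕ → Bool` no two of which are related.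

So a surjection from the Cantor space to `[0,1]` extends to a function `f` on `K` that is constant
on composants. A proper subcontinuum is mapped to a point and `K` is mapped onto `[0,1]`, so `f`
preserves continua. The union of two composants with different values is connected, being squeezed
between a connected dense set and its closure, but its image has exactly two points.
-/

/-! ### Components of closed subsets of compact spaces -/

section Components

variable {X : Type*} [TopologicalSpace X] [T2Space X]

/-- In a closed subset `F` of a compact Hausdorff space, a component contained in an open set `U`
has a neighbourhood contained in `U` that is clopen relative to `F`. -/
lemma exists_relClopen_of_connectedComponentIn_subset [CompactSpace X] {F U : Set X}
    (hF : IsClosed F) (hU : IsOpen U) {x : X} (hx : x ∈ F) (h : connectedComponentIn F x ⊆ U) :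
    ∃ Z ⊆ F, Z ⊆ U ∧ x ∈ Z ∧ IsClosed Z ∧ IsClosed (F \ Z) := by
  have : CompactSpace F := isCompact_iff_compactSpace.1 hF.isCompact
  let N := {s : Set F // IsClopen s ∧ (⟨x, hx⟩ : F) ∈ s}
  have : Nonempty N := ⟨⟨Set.univ, isClopen_univ, Set.mem_univ _⟩⟩
  have hdir : Directed (· ⊇ ·) fun s : N => s.val := by
    rintro ⟨s, hs, hxs⟩ ⟨t, ht, hxt⟩
    exact ⟨⟨s ∩ t, hs.inter ht, hxs, hxt⟩, Set.inter_subset_left, Set.inter_subset_right⟩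
  obtain ⟨⟨s, hs, hxs⟩, hsU⟩ := exists_subset_nhds_of_isCompact (U := Subtype.val ⁻¹' U) hdir
    (fun i => i.2.1.1.isCompact) (by
      intro y hy
      rw [← connectedComponent_eq_iInter_isClopen] at hy
      refine (hU.preimage continuous_subtype_val).mem_nhds (h ?_)
      rw [connectedComponentIn_eq_image hx]
      exact ⟨y, hy, rfl⟩)
  refine ⟨Subtype.val '' s, by simp, Set.image_subset_iff.2 hsU, ⟨_, hxs, rfl⟩,
    hF.isClosedEmbedding_subtypeVal.isClosedMap _ hs.1, ?_⟩
  have : F \ Subtype.val '' s = Subtype.val '' sᶜ := by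
    ext y
    simp only [Set.mem_sdiff, Set.mem_image, Subtype.exists, Set.mem_compl_iff]
    grind
  rw [this]
  exact hF.isClosedEmbedding_subtypeVal.isClosedMap _ hs.compl.1

/-- The relation "`x` and `y` lie in the same component of `F`". -/
def componentRel (F : Set X) : Set (X × X) := {p | p.1 ∈ F ∧ p.2 ∈ connectedComponentIn F p.1}

lemma isClosed_componentRel [CompactSpace X] {F : Set X} (hF : IsClosed F) :
    IsClosed (componentRel F) := by
  refine isOpen_compl_iff.1 (isOpen_iff_mem_nhds.2 ?_)
  rintro ⟨x, y⟩ hxy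
  by_cases hx : x ∈ F
  · have hy : connectedComponentIn F x ⊆ {y}ᶜ := by
      rintro z hz rfl
      exact hxy ⟨hx, hz⟩
    obtain ⟨Z, hZF, hZy, hxZ, hZ, hFZ⟩ :=
      exists_relClopen_of_connectedComponentIn_subset hF isOpen_compl_singleton hx hy
    have hyZ : y ∉ Z := fun h => hZy h rfl
    refine Filter.mem_of_superset (prod_mem_nhds (hFZ.isOpen_compl.mem_nhds (x := x) (by simp [hxZ]))
      (hZ.isOpen_compl.mem_nhds hyZ)) ?_
    rintro ⟨a, b⟩ ⟨ha, hb⟩ ⟨haF, hab⟩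
    -- The component of `a` in `F` would be split by `Z` and `F \ Z`.
    have haZ : a ∈ Z := by
      by_contra haZ
      exact ha ⟨haF, haZ⟩
    have hcF := connectedComponentIn_subset F a
    obtain ⟨c, -, hc1, hc2⟩ := isPreconnected_closed_iff.1
      (isPreconnected_connectedComponentIn (F := F) (x := a)) Z (F \ Z) hZ hFZ
      (fun c hc => by
        by_cases hcZ : c ∈ Z
        · exact .inl hcZ
        · exact .inr ⟨hcF hc, hcZ⟩)
      ⟨a, mem_connectedComponentIn haF, haZ⟩ ⟨b, hab, hcF hab, hb⟩
    exact hc2.2 hc1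
  · refine Filter.mem_of_superset (prod_mem_nhds (hF.isOpen_compl.mem_nhds hx) Filter.univ_mem) ?_
    rintro ⟨a, b⟩ ⟨ha, -⟩ h
    exact ha h.1

lemma isContinuum_connectedComponentIn [CompactSpace X] {F : Set X} (hF : IsClosed F) {x : X}
    (hx : x ∈ F) : IsContinuum (connectedComponentIn F x) := by
  refine ⟨?_, isConnected_connectedComponentIn_iff.2 hx⟩
  have : IsClosed (connectedComponentIn F x) := by
    rw [connectedComponentIn_eq_image hx]
    exact hF.isClosedEmbedding_subtypeVal.isClosedMap _ isClosed_connectedComponent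
  exact this.isCompact

end Components

/-! ### Cantor families avoiding closed relations with empty interior -/

section Cantor

variable {X : Type*} [TopologicalSpace X]

/-- Finitely many nonempty open sets can be shrunk so that points of different sets are not
related by a given closed relation with empty interior. The family is kept open, and the closures
are contained in the original sets, so that the step can be iterated. -/
lemma exists_shrink_avoiding [RegularSpace X] {ι : Type*} [Finite ι] {R : Set (X × X)}
    (hR : IsClosed R) (hd : Dense Rᶜ) (D : ι → Set X) (hD : ∀ i, IsOpen (D i) ∧ (D i).Nonempty) :
    ∃ V : ι → Set X, (∀ i, IsOpen (V i) ∧ (V i).Nonempty) ∧ (∀ i, closure (V i) ⊆ D i) ∧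
      ∀ i j, i ≠ j → ∀ a ∈ V i, ∀ b ∈ V j, (a, b) ∉ R := by
  classical
  -- A finite set of pairs is treated by induction, one pair at a time.
  have key : ∀ P : Finset (ι × ι), ∃ W : ι → Set X, (∀ i, IsOpen (W i) ∧ (W i).Nonempty) ∧
      (∀ i, W i ⊆ D i) ∧
      ∀ p ∈ P, p.1 ≠ p.2 → ∀ a ∈ W p.1, ∀ b ∈ W p.2, (a, b) ∉ R := by
    intro P
    induction P using Finset.induction_on with
    | empty => exact ⟨D, hD, fun _ => subset_rfl, by simp⟩
    | insert p P _ ih =>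
      obtain ⟨W, hW, hWD, hWP⟩ := ih
      obtain ⟨⟨a, b⟩, ⟨ha, hb⟩, hab⟩ := hd.inter_open_nonempty _ ((hW p.1).1.prod (hW p.2).1)
        ((hW p.1).2.prod (hW p.2).2)
      obtain ⟨A, B, hA, hB, haA, hbB, hAB⟩ := isOpen_prod_iff.1 hR.isOpen_compl a b hab
      by_cases hp : p.1 = p.2
      · refine ⟨W, hW, hWD, fun q hq => ?_⟩
        rcases Finset.mem_insert.1 hq with rfl | hq
        · exact fun h => (h hp).elim
        · exact hWP q hq
      · let W' : ι → Set X := fun i =>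
          if i = p.1 then W i ∩ A else if i = p.2 then W i ∩ B else W i
        have hW'W : ∀ i, W' i ⊆ W i := by
          intro i
          simp only [W']
          split_ifs <;> simp
        refine ⟨W', fun i => ?_, fun i => (hW'W i).trans (hWD i), fun q hq => ?_⟩
        · simp only [W']
          split_ifs with h1 h2
          · subst h1
            exact ⟨(hW _).1.inter hA, a, ha, haA⟩
          · subst h2
            exact ⟨(hW _).1.inter hB, b, hb, hbB⟩
          · exact hW i
        · rcases Finset.mem_insert.1 hq with rfl | hq
          · intro hne c hc d hd'
            simp only [W', if_true, if_neg (Ne.symm hne)] at hc hd'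
            exact hAB ⟨hc.2, hd'.2⟩
          · exact fun hne c hc d hd' => hWP q hq hne c (hW'W _ hc) d (hW'W _ hd')
  have := Fintype.ofFinite ι
  obtain ⟨W, hW, hWD, hWR⟩ := key Finset.univ
  have hV : ∀ i, ∃ V : Set X, (IsOpen V ∧ V.Nonempty) ∧ closure V ⊆ W i := by
    intro i
    obtain ⟨x, hx⟩ := (hW i).2
    obtain ⟨t, ht, htc, htW⟩ := exists_mem_nhds_isClosed_subset ((hW i).1.mem_nhds hx)
    exact ⟨interior t, ⟨isOpen_interior, x, mem_interior_iff_mem_nhds.2 ht⟩,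
      (htc.closure_subset_iff.2 interior_subset).trans htW⟩
  choose V hV hVW using hV
  exact ⟨V, hV, fun i => (hVW i).trans (hWD i), fun i j hij a ha b hb =>
    hWR (i, j) (Finset.mem_univ _) hij a (hVW i (subset_closure ha)) b
      (hVW j (subset_closure hb))⟩

/-- Mycielski's theorem for compact spaces: given countably many closed relations with empty
interior, there are continuum many points no two of which are related. -/
lemma exists_cantor_family [CompactSpace X] [T2Space X] [Nonempty X] (R : ℕ → Set (X × X))
    (hR : ∀ n, IsClosed (R n)) (hd : ∀ n, Dense (R n)ᶜ) :
    ∃ p : (ℕ → Bool) → X, ∀ σ τ, σ ≠ τ → ∀ n, (p σ, p τ) ∉ R n := by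
  -- Replacing `R n` by `⋃ k ≤ n, R k`, the relations increase with `n`.
  let S : ℕ → Set (X × X) := fun n => ⋃ k ∈ Set.Iic n, R k
  have hS : ∀ n, IsClosed (S n) := fun n => (Set.finite_Iic n).isClosed_biUnion fun k _ => hR k
  have hSd : ∀ n, Dense (S n)ᶜ := by
    intro n
    simp only [S, Set.compl_iUnion]
    exact dense_biInter_of_isOpen (fun k _ => (hR k).isOpen_compl) (Set.to_countable _)
      fun k _ => hd k
  let T : ℕ → Type _ := fun n =>
    {D : (Fin n → Bool) → Set X // ∀ s, IsOpen (D s) ∧ (D s).Nonempty}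
  have step : ∀ n (D : T n), ∃ E : T (n + 1),
      (∀ s, closure (E.1 s) ⊆ D.1 (fun i => s i.castSucc)) ∧
      ∀ s t, s ≠ t → ∀ a ∈ E.1 s, ∀ b ∈ E.1 t, (a, b) ∉ S n := by
    intro n D
    obtain ⟨V, h1, h2, h3⟩ := exists_shrink_avoiding (hS n) (hSd n)
      (fun s : Fin (n + 1) → Bool => D.1 (fun i => s i.castSucc)) (fun s => D.2 _)
    exact ⟨⟨V, h1⟩, h2, h3⟩
  choose next hnext1 hnext2 using step
  let D : ∀ n, T n := fun n =>
    Nat.rec ⟨fun _ => Set.univ, fun _ => ⟨isOpen_univ, Set.univ_nonempty⟩⟩ next n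
  let C : (ℕ → Bool) → ℕ → Set X := fun σ n => (D n).1 fun i => σ i
  have hC : ∀ σ n, closure (C σ (n + 1)) ⊆ C σ n := fun σ n => hnext1 n (D n) fun i => σ i
  have hne : ∀ σ, (⋂ n, closure (C σ n)).Nonempty := by
    intro σ
    refine IsCompact.nonempty_iInter_of_sequence_nonempty_isCompact_isClosed _
      (fun n => (hC σ n).trans subset_closure) (fun n => ((D n).2 _).2.closure)
      isClosed_closure.isCompact fun n => isClosed_closure
  choose p hp using hne
  have hpC : ∀ σ n, p σ ∈ C σ n := fun σ n => hC σ n (Set.mem_iInter.1 (hp σ) (n + 1))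
  refine ⟨p, fun σ τ hστ n hn => ?_⟩
  obtain ⟨m, hm⟩ := Function.ne_iff.1 hστ
  -- At level `max m n + 1` the two branches have separated and `R n` is being avoided.
  refine hnext2 (max m n) (D _) (fun i => σ i) (fun i => τ i) (fun h => hm ?_) (p σ)
    (hpC σ (max m n + 1)) (p τ) (hpC τ (max m n + 1)) ?_
  · exact congrFun h ⟨m, by omega⟩
  · exact Set.mem_biUnion (show n ∈ Set.Iic (max m n) from le_max_right m n) hn

end Cantor

/-! ### Composants of indecomposable continua -/

section Composants

variable {K : Type*} [TopologicalSpace K] [T2Space K]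

lemma IsContinuum.union {A B : Set K} (hA : IsContinuum A) (hB : IsContinuum B)
    (h : (A ∩ B).Nonempty) : IsContinuum (A ∪ B) :=
  ⟨hA.1.union hB.1, hA.2.union h hB.2⟩

lemma IsContinuum.singleton (x : K) : IsContinuum ({x} : Set K) :=
  ⟨isCompact_singleton, isConnected_singleton⟩

lemma mem_composant_self [Nontrivial K] (x : K) : x ∈ composant x :=
  ⟨{x}, ⟨IsContinuum.singleton x, Set.singleton_ne_univ x, rfl⟩, rfl⟩

lemma isConnected_composant [Nontrivial K] (x : K) : IsConnected (composant x) :=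
  ⟨⟨x, mem_composant_self x⟩,
    isPreconnected_sUnion x _ (fun _ hA => hA.2.2) fun _ hA => hA.1.2.isPreconnected⟩

lemma mem_composant_comm {x y : K} : y ∈ composant x ↔ x ∈ composant y :=
  ⟨fun ⟨A, ⟨h1, h2, h3⟩, h4⟩ => ⟨A, ⟨h1, h2, h4⟩, h3⟩,
    fun ⟨A, ⟨h1, h2, h3⟩, h4⟩ => ⟨A, ⟨h1, h2, h4⟩, h3⟩⟩

lemma IsIndecomposableContinuum.mem_composant_trans (hK : IsIndecomposableContinuum K) {x y z : K}
    (hxy : y ∈ composant x) (hyz : z ∈ composant y) : z ∈ composant x := by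
  obtain ⟨A, ⟨hA, hA', hxA⟩, hyA⟩ := hxy
  obtain ⟨B, ⟨hB, hB', hyB⟩, hzB⟩ := hyz
  refine ⟨A ∪ B, ⟨hA.union hB ⟨y, hyA, hyB⟩, fun h => ?_, .inl hxA⟩, .inr hzB⟩
  exact (hK.2 A B hA hB h).elim hA' hB'

/-- If a subcontinuum `A` of a connected space is removed and the rest is split into two disjoint
open sets `U` and `V`, then `A ∪ U` is still a subcontinuum. -/
lemma isContinuum_union_of_compl_eq [CompactSpace K] [PreconnectedSpace K] {A U V : Set K}
    (hA : IsContinuum A) (hU : IsOpen U) (hV : IsOpen V) (hUV : Disjoint U V)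
    (h : Aᶜ = U ∪ V) : IsContinuum (A ∪ U) := by
  have hAU : A ∪ U = Vᶜ := by
    ext x
    have h1 : x ∈ Aᶜ ↔ x ∈ U ∪ V := by rw [h]
    have h2 : x ∈ U → x ∉ V := fun h h' => Set.disjoint_left.1 hUV h h'
    simp only [Set.mem_compl_iff, Set.mem_union] at h1 ⊢
    tauto
  have hcl : IsClosed (A ∪ U) := hAU ▸ hV.isClosed_compl
  refine ⟨hcl.isCompact, hA.2.nonempty.mono Set.subset_union_left, ?_⟩
  rw [isPreconnected_iff_subset_of_fully_disjoint_closed hcl]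
  -- The part of a separation that misses `A` is contained in `U`, so it is clopen in `K`.
  have aux : ∀ P Q : Set K, IsClosed P → IsClosed Q → A ∪ U ⊆ P ∪ Q → Disjoint P Q → A ⊆ P →
      A ∪ U ⊆ P := by
    intro P Q hP hQ hPQ hdis hAP
    have hQ' : (A ∪ U) ∩ Q = U ∩ Pᶜ := by
      ext x
      have h1 : x ∈ P → x ∉ Q := fun h h' => Set.disjoint_left.1 hdis h h'
      have h2 := @hPQ x
      have h3 := @hAP x
      simp only [Set.mem_union, Set.mem_inter_iff, Set.mem_compl_iff] at h2 ⊢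
      tauto
    have hclopen : IsClopen ((A ∪ U) ∩ Q) := ⟨hcl.inter hQ, hQ' ▸ hU.inter hP.isOpen_compl⟩
    rcases isClopen_iff.1 hclopen with h0 | h0
    · intro x hx
      refine (hPQ hx).resolve_right fun hxQ => ?_
      exact (h0 ▸ (⟨hx, hxQ⟩ : x ∈ (A ∪ U) ∩ Q) : x ∈ (∅ : Set K))
    · obtain ⟨x, hx⟩ := hA.2.nonempty
      have : x ∈ (A ∪ U) ∩ Q := h0 ▸ Set.mem_univ x
      exact (Set.disjoint_left.1 hdis (hAP hx) this.2).elim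
  intro P Q hP hQ hPQ hdis
  rcases (isPreconnected_iff_subset_of_fully_disjoint_closed hA.1.isClosed).1 hA.2.isPreconnected
    P Q hP hQ (Set.subset_union_left.trans hPQ) hdis with hAP | hAQ
  · exact .inl (aux P Q hP hQ hPQ hdis hAP)
  · exact .inr (aux Q P hQ hP (Set.union_comm P Q ▸ hPQ) hdis.symm hAQ)

lemma IsIndecomposableContinuum.interior_eq_empty (hK : IsIndecomposableContinuum K) {A : Set K}
    (hA : IsContinuum A) (hA' : A ≠ Set.univ) : interior A = ∅ := by
  have : CompactSpace K := ⟨hK.1.1⟩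
  have : PreconnectedSpace K := ⟨hK.1.2.isPreconnected⟩
  by_contra hint
  have hne : (Aᶜ).Nonempty := Set.nonempty_compl.2 hA'
  by_cases hc : IsPreconnected Aᶜ
  · -- `K` is the union of `A` and the closure of its complement.
    have hB : IsContinuum (closure Aᶜ) :=
      ⟨isClosed_closure.isCompact, hne.closure, hc.closure⟩
    rcases hK.2 A _ hA hB (Set.eq_univ_of_forall fun x =>
      (em (x ∈ A)).imp id fun h => subset_closure h) with h | h
    · exact hA' h
    · rw [closure_compl, Set.compl_univ_iff] at h
      exact hint h
  · -- `K` is the union of the two continua obtained by adding to `A` one side of a separation.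
    obtain ⟨u, v, hu, hv, huv, ⟨a, haA, hau⟩, ⟨b, hbA, hbv⟩, hemp⟩ :
        ∃ u v : Set K, IsOpen u ∧ IsOpen v ∧ Aᶜ ⊆ u ∪ v ∧ (Aᶜ ∩ u).Nonempty ∧ (Aᶜ ∩ v).Nonempty ∧
          ¬ (Aᶜ ∩ (u ∩ v)).Nonempty := by
      simpa only [IsPreconnected, not_forall, exists_prop] using hc
    have hAo : IsOpen Aᶜ := hA.1.isClosed.isOpen_compl
    have hdis : Disjoint (Aᶜ ∩ u) (Aᶜ ∩ v) :=
      Set.disjoint_left.2 fun x hx hx' => hemp ⟨x, hx.1, hx.2, hx'.2⟩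
    have hcomp : Aᶜ = (Aᶜ ∩ u) ∪ (Aᶜ ∩ v) := by
      rw [← Set.inter_union_distrib_left, Set.inter_eq_left.2 huv]
    have h1 := isContinuum_union_of_compl_eq hA (hAo.inter hu) (hAo.inter hv) hdis hcomp
    have h2 := isContinuum_union_of_compl_eq hA (hAo.inter hv) (hAo.inter hu) hdis.symm
      (hcomp.trans (Set.union_comm _ _))
    rcases hK.2 _ _ h1 h2 (Set.eq_univ_of_forall fun x => by
      by_cases hx : x ∈ A
      · exact .inl (.inl hx)
      · exact (huv hx).imp (fun h => .inr ⟨hx, h⟩) fun h => .inr ⟨hx, h⟩) with h | h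
    · rcases h ▸ Set.mem_univ b with hb | hb
      · exact hbA hb
      · exact Set.disjoint_left.1 hdis hb ⟨hbA, hbv⟩
    · rcases h ▸ Set.mem_univ a with ha | ha
      · exact haA ha
      · exact Set.disjoint_left.1 hdis ⟨haA, hau⟩ ha

/-- Otherwise the component of `x` in the closure of a neighbourhood `U` of the closure of the
composant lies in `U`, and a clopen neighbourhood of it inside `U` disconnects the space. -/
lemma dense_composant [CompactSpace K] [PreconnectedSpace K] [Nontrivial K] (x : K) :
    Dense (composant x) := by
  by_contra hd
  obtain ⟨y, hy⟩ : ∃ y, y ∉ closure (composant x) := by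
    simpa only [Dense, not_forall] using hd
  obtain ⟨U, hU, hCU, hUy⟩ := normal_exists_closure_subset isClosed_closure
    (isOpen_compl_singleton (x := y)) (fun z hz h => hy (h ▸ hz))
  have hyU : y ∉ closure U := fun h => hUy h rfl
  have hxU : x ∈ closure U := subset_closure (hCU (subset_closure (mem_composant_self x)))
  have hA := isContinuum_connectedComponentIn isClosed_closure hxU
  have hAU : connectedComponentIn (closure U) x ⊆ U := by
    refine Set.Subset.trans (fun z hz => ?_) (subset_closure.trans hCU)
    exact ⟨_, ⟨hA, fun h => hyU (connectedComponentIn_subset (closure U) x (h ▸ Set.mem_univ y)),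
      mem_connectedComponentIn hxU⟩, hz⟩
  obtain ⟨Z, -, hZU, hxZ, hZ, hZ'⟩ :=
    exists_relClopen_of_connectedComponentIn_subset isClosed_closure hU hxU hAU
  have hZo : IsOpen Z := by
    have : Z = U ∩ (closure U \ Z)ᶜ := by
      ext z
      have h1 := @hZU z
      have h2 := @subset_closure _ _ U z
      simp only [Set.mem_inter_iff, Set.mem_compl_iff, Set.mem_sdiff]
      tauto
    rw [this]
    exact hU.inter hZ'.isOpen_compl
  have hZuniv := IsClopen.eq_univ ⟨hZ, hZo⟩ ⟨x, hxZ⟩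
  exact hyU (subset_closure (hZU (hZuniv ▸ Set.mem_univ y)))

/-- Mazurkiewicz's theorem: an indecomposable continuum has at least continuum many composants. -/
lemma IsIndecomposableContinuum.exists_cantor_family_composant [SecondCountableTopology K]
    (hK : IsIndecomposableContinuum K) :
    ∃ p : (ℕ → Bool) → K, ∀ σ τ, σ ≠ τ → p τ ∉ composant (p σ) := by
  have : CompactSpace K := ⟨hK.1.1⟩
  have : Nonempty K := hK.1.2.nonempty.to_type
  obtain ⟨b, hbc, hb0, hb⟩ := TopologicalSpace.exists_countable_basis K
  have hbne : b.Nonempty := by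
    obtain ⟨x, -⟩ := hK.1.2.nonempty
    obtain ⟨v, hv, -⟩ := hb.exists_subset_of_mem_open (Set.mem_univ x) isOpen_univ
    exact ⟨v, hv⟩
  obtain ⟨B, rfl⟩ := hbc.exists_eq_range hbne
  have hBo : ∀ n, IsOpen (B n) := fun n => hb.isOpen ⟨n, rfl⟩
  have hBne : ∀ n, (B n).Nonempty := fun n =>
    Set.nonempty_iff_ne_empty.2 fun h => hb0 ⟨n, h⟩
  obtain ⟨p, hp⟩ := exists_cantor_family (fun n => componentRel (B n)ᶜ)
    (fun n => isClosed_componentRel (hBo n).isClosed_compl) (fun n => by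
      rw [← interior_eq_empty_iff_dense_compl, Set.eq_empty_iff_forall_notMem]
      rintro ⟨x, y⟩ hxy
      have hsub : (fun z => (x, z)) ⁻¹' interior (componentRel (B n)ᶜ) ⊆
          connectedComponentIn (B n)ᶜ x := fun z hz => (interior_subset hz).2
      have hA := isContinuum_connectedComponentIn (hBo n).isClosed_compl (interior_subset hxy).1
      obtain ⟨z, hz⟩ := hBne n
      have hint := hK.interior_eq_empty hA fun h =>
        connectedComponentIn_subset (B n)ᶜ x (h ▸ Set.mem_univ z) hz
      have hy : y ∈ interior (connectedComponentIn (B n)ᶜ x) :=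
        interior_maximal hsub (isOpen_interior.preimage (by fun_prop)) hxy
      rw [hint] at hy
      exact hy)
  refine ⟨p, fun σ τ hστ hmem => ?_⟩
  obtain ⟨A, ⟨hA, hA', hσ⟩, hτ⟩ := hmem
  obtain ⟨y, hy⟩ := Set.nonempty_compl.2 hA'
  obtain ⟨_, ⟨n, rfl⟩, -, hn⟩ := hb.exists_subset_of_mem_open hy hA.1.isClosed.isOpen_compl
  have hAB : A ⊆ (B n)ᶜ := Set.subset_compl_comm.1 hn
  exact hp σ τ hστ n ⟨hAB hσ, hA.2.isPreconnected.subset_connectedComponentIn hσ hAB hτ⟩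

end Composants

/-! ### The function constant on composants -/

theorem mainTheorem7 {K : Type*} [TopologicalSpace K] [TopologicalSpace.MetrizableSpace K]
    [Nontrivial K] (hK : IsIndecomposableContinuum K) :
    ∃ f : K → unitInterval,
      ContinuumPreserving f ∧ ¬ ConnectednessPreserving f ∧
      (∀ x : K, ∃ t : unitInterval, f '' composant x = {t}) ∧
      Function.Surjective f := by
  have : CompactSpace K := ⟨hK.1.1⟩
  have : PreconnectedSpace K := ⟨hK.1.2.isPreconnected⟩
  let := TopologicalSpace.metrizableSpaceMetric K
  have : SecondCountableTopology K := inferInstance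
  obtain ⟨p, hp⟩ := hK.exists_cantor_family_composant
  obtain ⟨e, -, he⟩ := exists_nat_bool_continuous_surjective_of_compact unitInterval
  let s : Setoid K := ⟨fun x y => y ∈ composant x, mem_composant_self, mem_composant_comm.1,
    hK.mem_composant_trans⟩
  have hinj : Function.Injective fun σ => (Quotient.mk s (p σ)) := by
    intro σ τ h
    by_contra hne
    exact hp σ τ hne (Quotient.exact h)
  -- Composants that contain no point `p σ` are sent to the arbitrary value `0`.
  let f : K → unitInterval := fun x =>
    Function.extend (fun σ => Quotient.mk s (p σ)) e (fun _ => 0) (Quotient.mk s x)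
  have hf : ∀ x, ∀ y ∈ composant x, f y = f x := fun x y hy =>
    congrArg (Function.extend (fun σ => Quotient.mk s (p σ)) e fun _ => 0)
      (Quotient.sound (mem_composant_comm.1 hy : x ∈ composant y))
  have hsurj : Function.Surjective f := by
    intro t
    obtain ⟨σ, rfl⟩ := he t
    exact ⟨p σ, hinj.extend_apply e _ σ⟩
  refine ⟨f, ?_, ?_, fun x => ⟨f x, ?_⟩, hsurj⟩
  · intro A hA
    by_cases hA' : A = Set.univ
    · rw [hA', Set.image_univ, hsurj.range_eq]
      exact ⟨isCompact_univ, isConnected_univ⟩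
    · obtain ⟨x, hx⟩ := hA.2.nonempty
      have : f '' A = {f x} := by
        refine Set.eq_singleton_iff_unique_mem.2 ⟨⟨x, hx, rfl⟩, ?_⟩
        rintro _ ⟨y, hy, rfl⟩
        exact hf x y ⟨A, ⟨hA, hA', hx⟩, hy⟩
      rw [this]
      exact IsContinuum.singleton _
  · intro h
    obtain ⟨x, hx⟩ := hsurj 0
    obtain ⟨y, hy⟩ := hsurj 1
    have hconn : IsConnected (composant x ∪ composant y) :=
      (isConnected_composant x).subset_closure Set.subset_union_left
        ((dense_composant x).closure_eq ▸ Set.subset_univ _)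
    have himage : f '' (composant x ∪ composant y) ⊆ {0, 1} := by
      rintro _ ⟨z, hz | hz, rfl⟩
      · exact .inl ((hf x z hz).trans hx)
      · exact .inr ((hf y z hz).trans hy)
    obtain ⟨t, ht0, ht1⟩ := exists_between (zero_lt_one (α := unitInterval))
    have ht := (h _ hconn).isPreconnected.Icc_subset ⟨x, .inl (mem_composant_self x), hx⟩
      ⟨y, .inr (mem_composant_self y), hy⟩ ⟨ht0.le, ht1.le⟩
    exact (himage ht).elim ht0.ne' ht1.ne
  · refine Set.eq_singleton_iff_unique_mem.2 ⟨⟨x, mem_composant_self x, rfl⟩, ?_⟩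
    rintro _ ⟨y, hy, rfl⟩
    exact hf x y hy
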